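/- Let $b\ge 3$ be an odd integer and $\varepsilon\in[0,1]$. For an integer $l\ge 1$, the majority-voter step with range $l$ acts on configurations $\omega\in\{+,-\}^{\mathbb Z^2}$ as follows: independently of the other sites, each site $x$ picks $b$ sites independently and uniformly (repetitions allowed) in the square of $l^2$ lattice sites centred on $x$ (for even $l$: the square $x+\{-l/2,\dots,l/2-1\}^2$), and its new state is the majority of the states of the picked sites in $\omega$ with probability $1-\varepsilon$, and the opposite state with probability $\varepsilon$. Let $(l_t)_{t\ge 0}$ be positive integers and $\gamma_t=l_t^2$. For a horizon $T\ge 0$ and an initial probability measure $\mu$ on $\{+,-\}^{\mathbb Z^2}$ at time $0$, the intermediate model is run up to time $T$ with ranges counted backwards from $T$: for $0\le t<T$, the sites at time $T-t$ choose their neighbours at time $T-t-1$ in squares of $\gamma_t$ sites. Let $\mu_T$ be the resulting law at time $T$. The model is called ergodic if there is a probability measure $\nu$ such that $\mu_T\to\nu$ weakly as $T\to\infty$ for every initial probability measure $\mu$, and non-ergodic otherwise. **Theorem.** For every odd $b\ge 3$ there are real numbers $g_0,p_0$, depending only on $b$, such that: 1. there is $\varepsilon_0>0$ such that for all $0\le\varepsilon\le\varepsilon_0$,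 all real $g\ge g_0$, $p\ge p_0$ and all ranges with $\gamma_t=l_t^2=g\,p^t$ for every $t\ge0$, the intermediate model is non-ergodic; 2. for every $\eta>0$ there is $\varepsilon_0>0$ such that for all $0\le\varepsilon\le\varepsilon_0$, all real $g\ge g_0$, $p\ge p_0$, all ranges with $\gamma_t=l_t^2=g\,p^t$ for every $t\ge0$, and all $T\ge 0$, the probability that the origin is in state $-$ at time $T$, when all sites are in state $+$ at time $0$, is at most $\eta$. -/

import Mathlib

open MeasureTheory ProbabilityTheory Filter Topology unitInterval

namespace MajorityVoter

/-- The sites of the lattice `ℤ²`. -/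
abbrev Site : Type := ℤ × ℤ

/-- The configurations: `true` is the state `+`, `false` is the state `-`. The space carries the
product topology and the product `σ`-algebra. -/
abbrev Config : Type := Site → Bool

/-- The square of side `l`, with `l ^ 2` sites, centred on the site `x`. For odd `l = 2 m + 1` it is
`[x₁ - m, x₁ + m] × [x₂ - m, x₂ + m]`; for even `l` no square of lattice sites is exactly centred
on `x`, and the centre is off by half a lattice spacing. -/
noncomputable def box (l : ℕ+) (x : Site) : Finset Site :=
  Finset.Ico (x.1 - ((l : ℕ) / 2 : ℕ)) (x.1 - ((l : ℕ) / 2 : ℕ) + (l : ℕ)) ×ˢ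
    Finset.Ico (x.2 - ((l : ℕ) / 2 : ℕ)) (x.2 - ((l : ℕ) / 2 : ℕ) + (l : ℕ))

theorem card_box (l : ℕ+) (x : Site) : (box l x).card = (l : ℕ) ^ 2 := by
  simp [box, sq]

theorem box_nonempty (l : ℕ+) (x : Site) : (box l x).Nonempty := by
  rw [← Finset.card_pos, card_box]
  exact pow_pos l.pos 2

/-- The law of the `b` neighbours chosen by the site `x`: uniform on the sequences of `b` sites of
the square, so that the `b` choices are independent and uniform (and repetitions are possible). -/
noncomputable def choiceLaw (b : ℕ) (l : ℕ+) (x : Site) : PMF (Fin b → Site) :=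
  PMF.uniformOfFinset (Fintype.piFinset fun _ : Fin b => box l x)
    (Fintype.piFinset_nonempty.2 fun _ => box_nonempty l x)

/-- The majority among `b` states (for odd `b` there are no ties). -/
def majority {b : ℕ} (s : Fin b → Bool) : Bool :=
  decide (b < 2 * (Finset.univ.filter fun i => s i = true).card)

/-- The law of the new state of the site `x`, given the previous configuration `ω`: after the
choice of the neighbours, it is the opposite of their majority with probability `ε`, and their
majority with probability `1 - ε`. -/
noncomputable def siteLaw (b : ℕ) (ε : I) (l : ℕ+) (ω : Config) (x : Site) : Measure Bool :=
  (choiceLaw b l x).toMeasure.bind fun c =>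
    bernoulliMeasure (!majority fun i => ω (c i)) (majority fun i => ω (c i)) ε

instance (b : ℕ) (ε : I) (l : ℕ+) (ω : Config) (x : Site) :
    IsProbabilityMeasure (siteLaw b ε l ω x) :=
  isProbabilityMeasure_bind (measurable_of_countable _).aemeasurable
    (Eventually.of_forall fun _ => inferInstance)

theorem measurable_majority {b : ℕ} (c : Fin b → Site) :
    Measurable fun ω : Config => majority fun i => ω (c i) :=
  (measurable_of_countable (majority (b := b))).comp
    (measurable_pi_lambda _ fun i => measurable_pi_apply (c i))

theorem measurable_siteLaw (b : ℕ) (ε : I) (l : ℕ+) (x : Site) :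
    Measurable fun ω : Config => siteLaw b ε l ω x := by
  refine Measure.measurable_of_measurable_coe _ fun s hs => ?_
  have h : ∀ ω : Config, siteLaw b ε l ω x s =
      ∑' c, bernoulliMeasure (!majority fun i => ω (c i)) (majority fun i => ω (c i)) ε s *
        (choiceLaw b l x).toMeasure {c} := fun ω => by
    rw [siteLaw, Measure.bind_apply hs (measurable_of_countable _).aemeasurable,
      lintegral_countable']
  simp_rw [h]
  refine Measurable.tsum fun c => Measurable.mul_const ?_ _
  exact (measurable_of_countable fun m : Bool => bernoulliMeasure (!m) m ε s).comp
    (measurable_majority c)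

/-- One step of the majority voter automaton with interaction range `l`: given the previous
configuration `ω`, all sites are updated simultaneously and independently. -/
noncomputable def step (b : ℕ) (ε : I) (l : ℕ+) : Kernel Config Config where
  toFun ω := Measure.infinitePi fun x => siteLaw b ε l ω x
  measurable' := by
    refine Measurable.measure_of_isPiSystem_of_isProbabilityMeasure
      (generateFrom_squareCylinders (α := fun _ : Site => Bool)).symm
      (isPiSystem_squareCylinders (fun _ => MeasurableSpace.isPiSystem_measurableSet)
        fun _ => Set.mem_ofPred_eq ▸ MeasurableSet.univ) ?_
    rintro _ ⟨s, t, ht, rfl⟩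
    simp only [Set.mem_univ_pi, Set.mem_ofPred_eq] at ht
    simp_rw [Measure.infinitePi_pi _ fun i _ => ht i]
    exact Finset.measurable_fun_prod s fun x _ =>
      (Measure.measurable_coe (ht x)).comp (measurable_siteLaw b ε l x)

instance (b : ℕ) (ε : I) (l : ℕ+) : IsMarkovKernel (step b ε l) :=
  ⟨fun ω => inferInstanceAs
    (IsProbabilityMeasure (Measure.infinitePi fun x => siteLaw b ε l ω x))⟩

/-- The action of one step on the probability measures on configurations. -/
noncomputable def stepMeasure (b : ℕ) (ε : I) (l : ℕ+) (μ : ProbabilityMeasure Config) :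
    ProbabilityMeasure Config :=
  ⟨(μ : Measure Config).bind (step b ε l), inferInstance⟩

/-- The law at time `T` of the intermediate model started at time `0` from the law `μ`, with ranges
`l 0, l 1, …` counted backwards from the final time: for `t < T` the sites at time `T - t` choose
their neighbours at time `T - t - 1` in squares of side `l t`. So the first step, from time `0` to
time `1`, has range `l (T - 1)` and the last one has range `l 0`. -/
noncomputable def lawAt (b : ℕ) (ε : I) (l : ℕ → ℕ+) :
    ℕ → ProbabilityMeasure Config → ProbabilityMeasure Config
  | 0, μ => μ
  | T + 1, μ => lawAt b ε l T (stepMeasure b ε (l T) μ)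

/-- The intermediate model is ergodic if, as `T → ∞`, the law at time `T` converges weakly to one
and the same probability measure for all initial laws. -/
def IsErgodic (b : ℕ) (ε : I) (l : ℕ → ℕ+) : Prop :=
  ∃ ν : ProbabilityMeasure Config, ∀ μ : ProbabilityMeasure Config,
    Tendsto (fun T => lawAt b ε l T μ) atTop (𝓝 ν)

/-- The deterministic initial law: all sites are in the state `+`. -/
noncomputable def allPlus : ProbabilityMeasure Config := diracProba fun _ => true

end MajorityVoter

/-! Trace the ancestors of a site backwards from the final time. If no two choices ever coincide,
the genealogy is a `b`-ary tree and the one-site law follows a recursion. A majority against the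
initial consensus needs two bad neighbours, so the bad weight `q` becomes at most `ε + b² q²`, and
it stays below `2 ε` once `4 b² ε ≤ 1` (`treeWeight_not_le`).

Coincidences are controlled by `ProductApprox`. `m` sites choose `m b` sites, two of which coincide
with probability at most `(m b)² / γ`, so the error `δ` becomes at most `b² δ + b² / γ`. Since `γ_t
= g p^t` grows faster than `b^(2t)`, these errors sum to at most `2 b² / g`, uniformly in `T`
(`productApprox_lawAt`).

This error does not vanish with `ε`, while `g₀` may not depend on `η`. Hence the tree comparison is
stopped `n` steps before the end, where `g` is replaced by `g p^n`. The last `n` steps cost only a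
union bound, a factor `b` each, and `b^n / p^n` is small for large `n` (`real_siteState_lawAt_le`).
Choose `n` from `η`, then `ε₀`. Applied to both constant starts with `η = 1/4`, the bound excludes a
common limit. -/

namespace MajorityVoter

/-! ### Finite marginals of one step. -/

/-- The probability that a site whose chosen neighbours have majority `m` takes the state `s`. -/
def noise (ε : ℝ) (m s : Bool) : ℝ := if s = m then 1 - ε else ε

theorem noise_nonneg (ε : I) (m s : Bool) : 0 ≤ noise ε m s := by
  have h0 := ε.2.1
  have h1 := ε.2.2
  unfold noise
  split_ifs <;> linarith

theorem sum_noise (ε : ℝ) (m : Bool) : ∑ s, noise ε m s = 1 := by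
  cases m <;> simp [noise]

theorem bernoulliMeasure_real_singleton_eq_noise (ε : I) (m s : Bool) :
    (bernoulliMeasure (!m) m ε).real {s} = noise ε m s := by
  classical
  rw [bernoulliMeasure_real_apply _ (MeasurableSet.singleton s)]
  cases m <;> cases s <;> simp [noise]

theorem siteLaw_real_singleton (b : ℕ) (ε : I) (l : ℕ+) (ω : Config) (x : Site) (s : Bool) :
    (siteLaw b ε l ω x).real {s} =
      (∑ c ∈ Fintype.piFinset fun _ : Fin b => box l x,
        noise ε (majority fun j => ω (c j)) s) / (((l : ℕ) : ℝ) ^ 2) ^ b := by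
  have h : siteLaw b ε l ω x {s} = ∑' c,
      ENNReal.ofReal (noise ε (majority fun j => ω (c j)) s) * choiceLaw b l x c := by
    rw [siteLaw, Measure.bind_apply (MeasurableSet.singleton s)
      (measurable_of_countable _).aemeasurable, lintegral_countable']
    refine tsum_congr fun c => ?_
    rw [PMF.toMeasure_apply_singleton _ _ (MeasurableSet.singleton c),
      ← bernoulliMeasure_real_singleton_eq_noise, ofReal_measureReal]
  rw [measureReal_def, h, tsum_eq_sum (s := Fintype.piFinset fun _ : Fin b => box l x),
    ENNReal.toReal_sum, Finset.sum_div]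
  · refine Finset.sum_congr rfl fun c hc => ?_
    rw [choiceLaw, PMF.uniformOfFinset_apply_of_mem _ hc]
    simp [ENNReal.toReal_ofReal (noise_nonneg ε _ s), card_box, div_eq_mul_inv]
  · intro c _
    exact ENNReal.mul_ne_top ENNReal.ofReal_ne_top (PMF.apply_ne_top _ _)
  · intro c hc
    rw [choiceLaw, PMF.uniformOfFinset_apply_of_notMem _ hc, mul_zero]

theorem step_real_marginal {ι : Type} [Fintype ι] (b : ℕ) (ε : I) (l : ℕ+) (ω : Config) {x : ι → Site}
    (hx : Function.Injective x) (s : ι → Bool) :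
    (step b ε l ω).real {η | (fun i => η (x i)) = s} =
      ∏ i, (siteLaw b ε l ω (x i)).real {s i} := by
  -- The constraint at `y` is phrased through all `i` with `x i = y`, which avoids an inverse of
  -- `x`.
  have h : {η : Config | (fun i => η (x i)) = s} =
      Set.pi (Finset.univ.image x : Finset Site) fun y => {a | ∀ i, x i = y → a = s i} := by
    ext η
    simp only [Set.mem_ofPred_eq, Set.mem_pi, Finset.coe_image, Finset.coe_univ, Set.image_univ,
      Set.forall_mem_range, funext_iff]
    exact ⟨fun h i j hij => hx hij ▸ h i, fun h i => h i i rfl⟩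
  rw [measureReal_def, h]
  change (Measure.infinitePi (fun y => siteLaw b ε l ω y) _).toReal = _
  rw [Measure.infinitePi_pi _ fun _ _ => MeasurableSet.of_discrete,
    Finset.prod_image fun _ _ _ _ e => hx e, ENNReal.toReal_prod]
  refine Finset.prod_congr rfl fun i _ => ?_
  rw [measureReal_def]
  congr 2
  ext a
  simp only [Set.mem_ofPred_eq, Set.mem_singleton_iff]
  exact ⟨fun h => h i rfl, fun h j hij => hx hij ▸ h⟩

theorem measurable_marginal {ι : Type} (x : ι → Site) : Measurable fun (η : Config) i => η (x i) :=
  measurable_pi_lambda _ fun i => measurable_pi_apply (x i)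

theorem integrable_marginal {ι : Type} [Fintype ι] (μ : Measure Config) [IsFiniteMeasure μ] (x : ι → Site)
    (F : (ι → Bool) → ℝ) : Integrable (fun η => F fun i => η (x i)) μ :=
  Integrable.comp_measurable (f := fun (η : Config) i => η (x i)) (g := F) .of_finite
    (measurable_marginal x)

section Marginals

variable {ι : Type} [Fintype ι] [DecidableEq ι]

/-- The conditional expectation of a function `F` of the new states of the sites `i : ι`, as a
function of the states of the chosen neighbours. -/
def pullback (b : ℕ) (ε : ℝ) (F : (ι → Bool) → ℝ) (τ : ι × Fin b → Bool) : ℝ :=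
  ∑ s, F s * ∏ i, noise ε (majority fun j => τ (i, j)) (s i)

theorem sum_prod_noise (ε : ℝ) (m : ι → Bool) : ∑ s : ι → Bool, ∏ i, noise ε (m i) (s i) = 1 := by
  rw [← Fintype.prod_sum (fun i s => noise ε (m i) s)]
  exact Finset.prod_eq_one fun i _ => sum_noise ε (m i)

theorem pullback_nonneg (b : ℕ) (ε : I) {F : (ι → Bool) → ℝ} (hF : ∀ s, 0 ≤ F s)
    (τ : ι × Fin b → Bool) : 0 ≤ pullback b ε F τ :=
  Finset.sum_nonneg fun s _ =>
    mul_nonneg (hF s) (Finset.prod_nonneg fun _ _ => noise_nonneg ε _ _)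

theorem pullback_le_one (b : ℕ) (ε : I) {F : (ι → Bool) → ℝ} (hF : ∀ s, F s ≤ 1)
    (τ : ι × Fin b → Bool) : pullback b ε F τ ≤ 1 := by
  rw [← sum_prod_noise (ε : ℝ) fun i => majority fun j => τ (i, j)]
  exact Finset.sum_le_sum fun s _ => mul_le_of_le_one_left
    (Finset.prod_nonneg fun _ _ => noise_nonneg ε _ _) (hF s)

theorem integral_marginal (μ : Measure Config) [IsFiniteMeasure μ] (x : ι → Site)
    (F : (ι → Bool) → ℝ) : ∫ η, F (fun i => η (x i)) ∂μ =
      ∑ s, F s * μ.real {η | (fun i => η (x i)) = s} := by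
  rw [← integral_map (f := F) (measurable_marginal x).aemeasurable
    (measurable_of_countable F).aestronglyMeasurable, integral_fintype .of_finite]
  refine Finset.sum_congr rfl fun s _ => ?_
  rw [map_measureReal_apply (measurable_marginal x) (MeasurableSet.singleton s), smul_eq_mul,
    mul_comm]
  rfl

theorem integral_step (b : ℕ) (ε : I) (l : ℕ+) (ω : Config) {x : ι → Site}
    (hx : Function.Injective x) (F : (ι → Bool) → ℝ) :
    ∫ η, F (fun i => η (x i)) ∂(step b ε l ω) =
      (∑ c ∈ Fintype.piFinset fun a : ι × Fin b => box l (x a.1),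
        pullback b ε F fun a => ω (c a)) /
          (((l : ℕ) : ℝ) ^ 2) ^ (Fintype.card (ι × Fin b)) := by
  rw [integral_marginal]
  simp_rw [step_real_marginal b ε l ω hx, siteLaw_real_singleton, Finset.prod_div_distrib,
    Finset.prod_const, Finset.prod_univ_sum, pullback]
  rw [Finset.sum_comm, Finset.sum_div]
  refine Finset.sum_congr rfl fun s _ => ?_
  rw [mul_div_assoc', Fintype.card_prod, Fintype.card_fin, Finset.card_univ, ← Finset.mul_sum,
    ← pow_mul _ b, mul_comm (Fintype.card ι) b]
  congr 2
  refine Finset.sum_bij' (fun c _ a => c a.1 a.2) (fun c _ i j => c (i, j)) ?_ ?_ ?_ ?_ ?_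
  · intro c hc
    simp only [Fintype.mem_piFinset] at hc ⊢
    exact fun a => hc a.1 a.2
  · intro c hc
    simp only [Fintype.mem_piFinset] at hc ⊢
    exact fun i j => hc (i, j)
  · intros; rfl
  · intros; rfl
  · intros; rfl

theorem integral_stepMeasure (b : ℕ) (ε : I) (l : ℕ+) (μ : ProbabilityMeasure Config)
    {x : ι → Site} (hx : Function.Injective x) (F : (ι → Bool) → ℝ) :
    ∫ η, F (fun i => η (x i)) ∂(stepMeasure b ε l μ : Measure Config) =
      (∑ c ∈ Fintype.piFinset fun a : ι × Fin b => box l (x a.1),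
        ∫ ω, pullback b ε F (fun a => ω (c a)) ∂(μ : Measure Config)) /
          (((l : ℕ) : ℝ) ^ 2) ^ (Fintype.card (ι × Fin b)) := by
  have h : ∫ η, F (fun i => η (x i)) ∂(stepMeasure b ε l μ : Measure Config) =
      ∫ ω, ∫ η, F (fun i => η (x i)) ∂(step b ε l ω) ∂(μ : Measure Config) := by
    have hc : (stepMeasure b ε l μ : Measure Config) =
        (step b ε l ∘ₖ Kernel.const Unit (μ : Measure Config)) () := by
      rw [Kernel.comp_apply, Kernel.const_apply]
      rfl
    rw [hc, Kernel.integral_comp (integrable_marginal _ x F), Kernel.const_apply]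
  rw [h]
  simp_rw [integral_step b ε l _ hx F]
  rw [integral_div, integral_finsetSum]
  exact fun c _ => integrable_marginal _ c _

end Marginals

/-! ### Counting coincident choices. -/

/-- Overwriting the value at `i` by any element of `B i` loses nothing: the old value is still
readable at `j`. -/
theorem card_filter_eq_mul_card_le {κ α : Type*} [Fintype κ] [DecidableEq κ] [DecidableEq α]
    (B : κ → Finset α) {i j : κ} (hij : i ≠ j) :
    ((Fintype.piFinset B).filter fun c => c i = c j).card * (B i).card ≤
      (Fintype.piFinset B).card := by
  rw [← Finset.card_product]
  refine Finset.card_le_card_of_injOn (fun z => Function.update z.1 i z.2) ?_ ?_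
  · rintro ⟨c, y⟩ hz
    simp only [Finset.coe_product, Set.mem_prod, Finset.mem_coe, Finset.mem_filter,
      Fintype.mem_piFinset] at hz ⊢
    intro k
    by_cases hk : k = i
    · subst hk
      simpa using hz.2
    · simpa [hk] using hz.1.1 k
  · rintro ⟨c, y⟩ hz ⟨c', y'⟩ hz' h
    simp only [Finset.coe_product, Set.mem_prod, Finset.mem_coe, Finset.mem_filter] at hz hz' h
    have hk : ∀ k, k ≠ i → c k = c' k := fun k hk => by simpa [hk] using congrFun h k
    refine Prod.ext (funext fun k => ?_) (by simpa using congrFun h i)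
    by_cases hki : k = i
    · subst hki
      exact hz.1.2.trans ((hk j hij.symm).trans hz'.1.2.symm)
    · exact hk k hki

theorem card_filter_not_injective_mul_le {κ α : Type*} [Fintype κ] [DecidableEq κ]
    [DecidableEq α] (B : κ → Finset α) {n : ℕ} (hB : ∀ i, (B i).card = n)
    [DecidablePred fun c : κ → α => ¬ Function.Injective c] :
    ((Fintype.piFinset B).filter fun c => ¬ Function.Injective c).card * n ≤
      Fintype.card κ ^ 2 * (Fintype.piFinset B).card := by
  have hsub : ((Fintype.piFinset B).filter fun c => ¬ Function.Injective c) ⊆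
      (Finset.univ : Finset κ).offDiag.biUnion fun a =>
        (Fintype.piFinset B).filter fun c => c a.1 = c a.2 := by
    intro c hc
    rw [Finset.mem_filter] at hc
    obtain ⟨i, j, h, hij⟩ := Function.not_injective_iff.1 hc.2
    exact Finset.mem_biUnion.2 ⟨(i, j), by simpa using hij, Finset.mem_filter.2 ⟨hc.1, h⟩⟩
  calc _ ≤ (∑ a ∈ (Finset.univ : Finset κ).offDiag,
        ((Fintype.piFinset B).filter fun c => c a.1 = c a.2).card) * n :=
        Nat.mul_le_mul_right _ ((Finset.card_le_card hsub).trans Finset.card_biUnion_le)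
    _ ≤ ∑ _a ∈ (Finset.univ : Finset κ).offDiag, (Fintype.piFinset B).card := by
        rw [Finset.sum_mul]
        refine Finset.sum_le_sum fun a ha => ?_
        rw [← hB a.1]
        exact card_filter_eq_mul_card_le B (Finset.mem_offDiag.1 ha).2.2
    _ ≤ _ := by
        rw [Finset.sum_const, smul_eq_mul, Finset.offDiag_card, Finset.card_univ, sq]
        exact Nat.mul_le_mul_right _ (Nat.sub_le _ _)

/-! ### Independent neighbours and approximate independence. -/

/-- The law of the state of a site whose `b` neighbours are independent of law `w`. -/
def nextWeight (b : ℕ) (ε : ℝ) (w : Bool → ℝ) (s : Bool) : ℝ :=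
  ∑ τ : Fin b → Bool, noise ε (majority τ) s * ∏ j, w (τ j)

theorem sum_prod_eq_one {ι : Type*} [Fintype ι] [DecidableEq ι] {w : Bool → ℝ}
    (hw : ∑ s, w s = 1) : ∑ s : ι → Bool, ∏ i, w (s i) = 1 := by
  rw [← Fintype.prod_sum (fun _ s => w s)]
  exact Finset.prod_eq_one fun _ _ => hw

theorem nextWeight_nonneg (b : ℕ) (ε : I) {w : Bool → ℝ} (hw : ∀ s, 0 ≤ w s) (s : Bool) :
    0 ≤ nextWeight b ε w s :=
  Finset.sum_nonneg fun _ _ =>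
    mul_nonneg (noise_nonneg ε _ _) (Finset.prod_nonneg fun _ _ => hw _)

theorem sum_nextWeight (b : ℕ) (ε : ℝ) {w : Bool → ℝ} (hw : ∑ s, w s = 1) :
    ∑ s, nextWeight b ε w s = 1 := by
  simp_rw [nextWeight]
  rw [Finset.sum_comm]
  simp_rw [← Finset.sum_mul, sum_noise, one_mul]
  exact sum_prod_eq_one hw

/-- Disjoint blocks of `b` independent states have independent noisy majorities, so product weights
are mapped to product weights. -/
theorem sum_pullback_mul_prod {ι : Type} [Fintype ι] [DecidableEq ι] (b : ℕ) (ε : ℝ)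
    (w : Bool → ℝ) (F : (ι → Bool) → ℝ) :
    ∑ τ, pullback b ε F τ * ∏ a, w (τ a) = ∑ s, F s * ∏ i, nextWeight b ε w (s i) := by
  simp_rw [pullback, nextWeight, Finset.sum_mul]
  rw [Finset.sum_comm]
  refine Finset.sum_congr rfl fun s _ => ?_
  rw [Fintype.prod_sum (fun i (τ : Fin b → Bool) => noise ε (majority τ) (s i) * ∏ j, w (τ j)),
    Finset.mul_sum]
  refine Fintype.sum_equiv (Equiv.curry ι (Fin b) Bool) _ _ fun τ => ?_
  rw [Finset.prod_mul_distrib, Fintype.prod_prod_type, mul_assoc]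
  rfl

/-- The marginals of `μ` on `m` distinct sites are within total variation distance `δ * m ^ 2` of
the product of the weights `w`. -/
def ProductApprox (μ : Measure Config) (w : Bool → ℝ) (δ : ℝ) : Prop :=
  ∀ (ι : Type) [Fintype ι] [DecidableEq ι] (x : ι → Site), Function.Injective x →
    ∀ F : (ι → Bool) → ℝ, (∀ s, 0 ≤ F s) → (∀ s, F s ≤ 1) →
      |∫ ω, F (fun i => ω (x i)) ∂μ - ∑ s, F s * ∏ i, w (s i)| ≤ δ * (Fintype.card ι : ℝ) ^ 2

theorem ProductApprox.mono {μ : Measure Config} {w : Bool → ℝ} {δ δ' : ℝ}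
    (h : ProductApprox μ w δ) (hδ : δ ≤ δ') : ProductApprox μ w δ' :=
  fun ι _ _ x hx F h0 h1 => (h ι x hx F h0 h1).trans (by gcongr)

theorem abs_integral_sub_sum_le_one {ι : Type} [Fintype ι] [DecidableEq ι] (μ : Measure Config)
    [IsProbabilityMeasure μ] {w : Bool → ℝ} (hw0 : ∀ s, 0 ≤ w s) (hw1 : ∑ s, w s = 1)
    (x : ι → Site) {F : (ι → Bool) → ℝ} (h0 : ∀ s, 0 ≤ F s) (h1 : ∀ s, F s ≤ 1) :
    |∫ ω, F (fun i => ω (x i)) ∂μ - ∑ s, F s * ∏ i, w (s i)| ≤ 1 := by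
  have hp : ∀ s : ι → Bool, 0 ≤ ∏ i, w (s i) := fun s => Finset.prod_nonneg fun _ _ => hw0 _
  have a0 : 0 ≤ ∫ ω, F (fun i => ω (x i)) ∂μ := integral_nonneg fun ω => h0 _
  have a1 : ∫ ω, F (fun i => ω (x i)) ∂μ ≤ 1 := by
    simpa using integral_mono (integrable_marginal μ x F) (integrable_const (1 : ℝ))
      fun ω => h1 _
  have b0 : 0 ≤ ∑ s, F s * ∏ i, w (s i) :=
    Finset.sum_nonneg fun s _ => mul_nonneg (h0 s) (hp s)
  have b1 : ∑ s, F s * ∏ i, w (s i) ≤ 1 := by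
    rw [← sum_prod_eq_one (ι := ι) hw1]
    exact Finset.sum_le_sum fun s _ => mul_le_of_le_one_left (hp s) (h1 s)
  rw [abs_le]
  constructor <;> linarith

theorem card_piFinset_box {ι : Type} [Fintype ι] [DecidableEq ι] (l : ℕ+) (x : ι → Site) :
    ((Fintype.piFinset fun i => box l (x i)).card : ℝ) =
      (((l : ℕ) : ℝ) ^ 2) ^ Fintype.card ι := by
  simp [Fintype.card_piFinset, card_box]

/-- The error is quadratic in the number of sites so that one form covers both sources: passing to
`m b` sites multiplies the old error by `b²`, and a coincidence among them has probability at most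
`(m b)² / l²`. -/
theorem ProductApprox.stepMeasure {b : ℕ} {ε : I} (l : ℕ+) {μ : ProbabilityMeasure Config}
    {w : Bool → ℝ} {δ : ℝ} (hw0 : ∀ s, 0 ≤ w s) (hw1 : ∑ s, w s = 1) (hδ : 0 ≤ δ)
    (h : ProductApprox μ w δ) :
    ProductApprox (stepMeasure b ε l μ) (nextWeight b ε w)
      ((b : ℝ) ^ 2 * δ + (b : ℝ) ^ 2 / ((l : ℕ) : ℝ) ^ 2) := by
  classical
  intro ι _ _ x hx F h0 h1
  have hl : (0 : ℝ) < ((l : ℕ) : ℝ) ^ 2 := pow_pos (Nat.cast_pos.2 l.pos) 2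
  have hN : 0 < (((l : ℕ) : ℝ) ^ 2) ^ Fintype.card (ι × Fin b) := pow_pos hl _
  rw [integral_stepMeasure b ε l μ hx F, ← sum_pullback_mul_prod]
  have hcard := card_piFinset_box l fun a : ι × Fin b => x a.1
  set S := Fintype.piFinset fun a : ι × Fin b => box l (x a.1)
  have hbad := card_filter_not_injective_mul_le (fun a : ι × Fin b => box l (x a.1))
    fun a => card_box l (x a.1)
  set N := (((l : ℕ) : ℝ) ^ 2) ^ Fintype.card (ι × Fin b)
  set P := ∑ τ : ι × Fin b → Bool, pullback b ε F τ * ∏ a, w (τ a)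
  set m : ℝ := ((Fintype.card (ι × Fin b) : ℕ) : ℝ) with hm
  have hbad' : ((S.filter fun c => ¬ Function.Injective c).card : ℝ) ≤
      m ^ 2 * N / ((l : ℕ) : ℝ) ^ 2 := by
    rw [le_div_iff₀ hl, ← hcard, hm]
    exact_mod_cast hbad
  -- Injective choices fall under the hypothesis on `μ`; the others get the trivial bound `1`.
  have hc : ∀ c ∈ S, |∫ ω, pullback b ε F (fun a => ω (c a)) ∂(μ : Measure Config) - P| ≤
      δ * m ^ 2 + if ¬ Function.Injective c then 1 else 0 := by
    intro c _
    by_cases hinj : Function.Injective c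
    · simp only [hinj, not_true_eq_false, if_false, add_zero]
      exact h _ c hinj _ (pullback_nonneg b ε h0) (pullback_le_one b ε h1)
    · have := abs_integral_sub_sum_le_one (μ : Measure Config) hw0 hw1 c
        (pullback_nonneg b ε h0) (pullback_le_one b ε h1)
      simp only [hinj, not_false_eq_true, if_true]
      exact this.trans (le_add_of_nonneg_left (by positivity))
  have hsplit : (∑ c ∈ S, ∫ ω, pullback b ε F (fun a => ω (c a)) ∂(μ : Measure Config)) / N - P =
      (∑ c ∈ S, (∫ ω, pullback b ε F (fun a => ω (c a)) ∂(μ : Measure Config) - P)) / N := by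
    rw [Finset.sum_sub_distrib, Finset.sum_const, nsmul_eq_mul, hcard, sub_div,
      mul_div_cancel_left₀ _ hN.ne']
  rw [hsplit, abs_div, abs_of_pos hN, div_le_iff₀ hN]
  calc _ ≤ ∑ c ∈ S, (δ * m ^ 2 + if ¬ Function.Injective c then 1 else 0) :=
        (Finset.abs_sum_le_sum_abs _ _).trans (Finset.sum_le_sum hc)
    _ = N * (δ * m ^ 2) + ((S.filter fun c => ¬ Function.Injective c).card : ℝ) := by
        rw [Finset.sum_add_distrib, Finset.sum_const, nsmul_eq_mul, hcard, Finset.sum_boole]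
    _ ≤ N * (δ * m ^ 2) + m ^ 2 * N / ((l : ℕ) : ℝ) ^ 2 := by gcongr
    _ = _ := by
        rw [hm, Fintype.card_prod, Fintype.card_fin]
        push_cast
        ring

/-! ### Stability of consensus on the tree. -/

theorem exists_ne_of_majority_eq_not {b : ℕ} (hb : 3 ≤ b) {τ : Fin b → Bool} {s : Bool}
    (h : majority τ = !s) : ∃ i j, i ≠ j ∧ τ i = !s ∧ τ j = !s := by
  have hsum := Finset.card_filter_add_card_filter_not (s := (Finset.univ : Finset (Fin b)))
    fun i => τ i = true
  simp only [Bool.not_eq_true, Finset.card_univ, Fintype.card_fin] at hsum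
  have hcard : 1 < (Finset.univ.filter fun i => τ i = !s).card := by
    cases s
    · have h' : b < 2 * (Finset.univ.filter fun i => τ i = true).card := of_decide_eq_true h
      simp only [Bool.not_false]
      omega
    · have h' : ¬ b < 2 * (Finset.univ.filter fun i => τ i = true).card := of_decide_eq_false h
      simp only [Bool.not_true]
      omega
  obtain ⟨i, hi, j, hj, hij⟩ := Finset.one_lt_card.1 hcard
  exact ⟨i, j, hij, (Finset.mem_filter.1 hi).2, (Finset.mem_filter.1 hj).2⟩

theorem sum_filter_pair_le {b : ℕ} {w : Bool → ℝ} (hw0 : ∀ s, 0 ≤ w s) (hw1 : ∑ s, w s = 1)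
    {i j : Fin b} (hij : i ≠ j) (a : Bool) :
    ∑ τ : Fin b → Bool, (if τ i = a ∧ τ j = a then ∏ k, w (τ k) else 0) ≤ w a ^ 2 := by
  -- The constraint is absorbed into the factors at `i` and `j`, so that the sum of products
  -- factorizes.
  let f : Fin b → Bool → ℝ := fun k s =>
    if k = i ∨ k = j then (if s = a then w a else 0) else w s
  have hf : ∀ k s, 0 ≤ f k s := fun k s => by
    have := hw0 a
    have := hw0 s
    dsimp only [f]
    split_ifs <;> first | assumption | exact le_rfl
  calc _ ≤ ∑ τ : Fin b → Bool, ∏ k, f k (τ k) := by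
        refine Finset.sum_le_sum fun τ _ => ?_
        split_ifs with h
        · refine (Finset.prod_congr rfl fun k _ => ?_).le
          by_cases hk : k = i ∨ k = j
          · have : τ k = a := by rcases hk with rfl | rfl <;> simp [h]
            simp [f, hk, this]
          · simp [f, hk]
        · exact Finset.prod_nonneg fun k _ => hf k _
    _ = ∏ k, ∑ s, f k s := (Fintype.prod_sum f).symm
    _ = ∏ k, if k ∈ ({i, j} : Finset (Fin b)) then w a else 1 := by
        refine Finset.prod_congr rfl fun k _ => ?_
        by_cases hk : k = i ∨ k = j
        · simp only [f, hk, if_true, Finset.sum_ite_eq', Finset.mem_univ, Finset.mem_insert,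
            Finset.mem_singleton]
        · simp only [f, hk, if_false, Finset.mem_insert, Finset.mem_singleton, hw1]
    _ = w a ^ 2 := by
        rw [Finset.prod_ite_mem, Finset.univ_inter, Finset.prod_const, Finset.card_pair hij]

theorem noise_le (ε : I) (m a : Bool) : noise ε m a ≤ ε + if m = a then 1 else 0 := by
  have h0 := ε.2.1
  unfold noise
  split_ifs with h1 h2 h2
  · linarith
  · exact absurd h1.symm h2
  · linarith
  · linarith

/-- Either the noise acts, or some pair of neighbours is in state `!s`; there are at most `b²`
ordered pairs. -/
theorem nextWeight_not_le {b : ℕ} (hb : 3 ≤ b) (ε : I) {w : Bool → ℝ} (hw0 : ∀ s, 0 ≤ w s)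
    (hw1 : ∑ s, w s = 1) (s : Bool) :
    nextWeight b ε w (!s) ≤ ε + (b : ℝ) ^ 2 * w (!s) ^ 2 := by
  have hp : ∀ τ : Fin b → Bool, 0 ≤ ∏ k, w (τ k) := fun τ =>
    Finset.prod_nonneg fun _ _ => hw0 _
  let D := (Finset.univ : Finset (Fin b)).offDiag
  have hterm : ∀ τ : Fin b → Bool, noise ε (majority τ) (!s) * ∏ k, w (τ k) ≤
      ε * ∏ k, w (τ k) +
        ∑ q ∈ D, if τ q.1 = (!s) ∧ τ q.2 = (!s) then ∏ k, w (τ k) else 0 := by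
    intro τ
    refine (mul_le_mul_of_nonneg_right (noise_le ε _ _) (hp τ)).trans ?_
    rw [add_mul]
    gcongr
    have hnn : ∀ q ∈ D, 0 ≤ if τ q.1 = (!s) ∧ τ q.2 = (!s) then ∏ k, w (τ k) else 0 :=
      fun q _ => by split_ifs; exacts [hp τ, le_rfl]
    split_ifs with hm
    · obtain ⟨i, j, hij, hi, hj⟩ := exists_ne_of_majority_eq_not hb hm
      have := Finset.single_le_sum hnn (show (i, j) ∈ D by simpa [D] using hij)
      simpa [hi, hj] using this
    · rw [zero_mul]
      exact Finset.sum_nonneg hnn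
  calc nextWeight b ε w (!s) ≤ _ := Finset.sum_le_sum fun τ _ => hterm τ
    _ = ε + ∑ q ∈ D, ∑ τ : Fin b → Bool,
          if τ q.1 = (!s) ∧ τ q.2 = (!s) then ∏ k, w (τ k) else 0 := by
        rw [Finset.sum_add_distrib, ← Finset.mul_sum, sum_prod_eq_one hw1, mul_one,
          Finset.sum_comm]
    _ ≤ ε + ∑ _q ∈ D, w (!s) ^ 2 := by
        gcongr with q hq
        exact sum_filter_pair_le hw0 hw1 (Finset.mem_offDiag.1 hq).2.2 _
    _ ≤ ε + (b : ℝ) ^ 2 * w (!s) ^ 2 := by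
        rw [Finset.sum_const, nsmul_eq_mul]
        gcongr
        have : D.card ≤ b ^ 2 := by simp [D, Finset.offDiag_card, sq]
        exact_mod_cast this

/-- The deterministic initial law: all sites are in the state `s`. -/
noncomputable def allEqual (s : Bool) : ProbabilityMeasure Config := diracProba fun _ => s

/-- The weights of the one-site law at time `T`, were the genealogy of the site a tree. -/
noncomputable def treeWeight (b : ℕ) (ε : ℝ) (s : Bool) : ℕ → Bool → ℝ
  | 0 => fun a => if a = s then 1 else 0
  | T + 1 => nextWeight b ε (treeWeight b ε s T)

theorem treeWeight_nonneg (b : ℕ) (ε : I) (s : Bool) (T : ℕ) (a : Bool) :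
    0 ≤ treeWeight b ε s T a := by
  induction T generalizing a with
  | zero => unfold treeWeight; split_ifs <;> norm_num
  | succ T ih => exact nextWeight_nonneg b ε ih a

theorem sum_treeWeight (b : ℕ) (ε : ℝ) (s : Bool) (T : ℕ) : ∑ a, treeWeight b ε s T a = 1 := by
  induction T with
  | zero => simp [treeWeight]
  | succ T ih => exact sum_nextWeight b ε ih

theorem treeWeight_not_le {b : ℕ} (hb : 3 ≤ b) {ε : I} (hε : 4 * (b : ℝ) ^ 2 * ε ≤ 1) (s : Bool)
    (T : ℕ) : treeWeight b ε s T (!s) ≤ 2 * ε := by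
  have h0 := ε.2.1
  induction T with
  | zero => simpa [treeWeight] using h0
  | succ T ih =>
    have hsq : treeWeight b ε s T (!s) ^ 2 ≤ (2 * (ε : ℝ)) ^ 2 :=
      pow_le_pow_left₀ (treeWeight_nonneg b ε s T _) ih 2
    calc treeWeight b ε s (T + 1) (!s) ≤ ε + (b : ℝ) ^ 2 * treeWeight b ε s T (!s) ^ 2 :=
          nextWeight_not_le hb ε (treeWeight_nonneg b ε s T) (sum_treeWeight b ε s T) s
      _ ≤ ε + (b : ℝ) ^ 2 * (2 * (ε : ℝ)) ^ 2 := by gcongr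
      _ = ε + (4 * (b : ℝ) ^ 2 * ε) * ε := by ring
      _ ≤ ε + 1 * ε := by gcongr
      _ = 2 * ε := by ring

/-! ### Comparison with the tree, uniformly in time. -/

theorem productApprox_allEqual (b : ℕ) (ε : ℝ) (s : Bool) :
    ProductApprox (allEqual s) (treeWeight b ε s 0) 0 := by
  intro ι _ _ x _ F _ _
  have hd : ((allEqual s : ProbabilityMeasure Config) : Measure Config) =
      Measure.dirac fun _ => s := rfl
  have hw : ∀ τ : ι → Bool, F τ * ∏ i, treeWeight b ε s 0 (τ i) =
      if τ = fun _ => s then F τ else 0 := by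
    intro τ
    simp only [treeWeight]
    rw [Finset.prod_ite_zero]
    simp [funext_iff]
  have hm : StronglyMeasurable fun ω : Config => F fun i => ω (x i) :=
    ((measurable_of_countable F).comp (measurable_marginal x)).stronglyMeasurable
  rw [hd, integral_dirac' _ _ hm]
  simp [hw]

/-- `lawAt` peels off the first step; inductions need the last one. The shifted ranges are again
geometric, with `g p` in place of `g`. -/
theorem lawAt_succ (b : ℕ) (ε : I) (l : ℕ → ℕ+) (T : ℕ) (μ : ProbabilityMeasure Config) :
    lawAt b ε l (T + 1) μ = stepMeasure b ε (l 0) (lawAt b ε (fun t => l (t + 1)) T μ) := by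
  induction T generalizing μ with
  | zero => rfl
  | succ T ih =>
    rw [lawAt, ih]
    rfl

/-- The bound `2 b² / g` reproduces itself under `δ(g) = b² δ(g p) + b² / g`, because `2 b² ≤ p`. -/
theorem productApprox_lawAt {b : ℕ} {p : ℝ} (hb : 0 < b) (hp : 2 * (b : ℝ) ^ 2 ≤ p) (ε : I)
    (s : Bool) (T : ℕ) {g : ℝ} (hg : 0 < g) {l : ℕ → ℕ+}
    (hl : ∀ t, ((l t : ℕ) : ℝ) ^ 2 = g * p ^ t) :
    ProductApprox (lawAt b ε l T (allEqual s)) (treeWeight b ε s T) (2 * (b : ℝ) ^ 2 / g) := by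
  have hb' : (0 : ℝ) < b := Nat.cast_pos.2 hb
  have hp0 : 0 < p := lt_of_lt_of_le (by positivity) hp
  induction T generalizing g l with
  | zero => exact (productApprox_allEqual b ε s).mono (by positivity)
  | succ T ih =>
    rw [lawAt_succ]
    have hl' : ∀ t, ((l (t + 1) : ℕ) : ℝ) ^ 2 = g * p * p ^ t := fun t => by
      rw [hl, pow_succ']
      ring
    refine ((ih (mul_pos hg hp0) hl').stepMeasure (l 0) (treeWeight_nonneg b ε s T)
      (sum_treeWeight b ε s T) (by positivity)).mono ?_
    rw [hl 0, pow_zero, mul_one]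
    calc (b : ℝ) ^ 2 * (2 * (b : ℝ) ^ 2 / (g * p)) + (b : ℝ) ^ 2 / g
        = (b : ℝ) ^ 2 / g * (2 * (b : ℝ) ^ 2 / p + 1) := by field_simp
      _ ≤ (b : ℝ) ^ 2 / g * (1 + 1) := by
          gcongr
          exact (div_le_one hp0).2 hp
      _ = 2 * (b : ℝ) ^ 2 / g := by ring

/-! ### One-site bounds and the union bound for the last steps. -/

theorem measurableSet_siteState (x : Site) (a : Bool) : MeasurableSet {ω : Config | ω x = a} :=
  (measurable_pi_apply x : Measurable fun ω : Config => ω x) (MeasurableSet.singleton a)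

theorem integral_siteState (μ : Measure Config) (x : Site) (a : Bool) :
    ∫ ω, (if ω x = a then 1 else 0 : ℝ) ∂μ = μ.real {ω | ω x = a} := by
  rw [← integral_indicator_one (measurableSet_siteState x a)]
  simp [Set.indicator_apply]

theorem ProductApprox.real_siteState_le {μ : Measure Config} {w : Bool → ℝ} {δ : ℝ}
    (h : ProductApprox μ w δ) (x : Site) (a : Bool) : μ.real {ω | ω x = a} ≤ w a + δ := by
  have := h Unit (fun _ => x) (fun _ _ _ => rfl) (fun τ => if τ () = a then 1 else 0)
    (fun _ => by split_ifs <;> norm_num) (fun _ => by split_ifs <;> norm_num)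
  rw [integral_siteState, ← (Equiv.funUnique Unit Bool).symm.sum_comp] at this
  simp only [Equiv.funUnique_symm_apply, uniqueElim_const, Finset.univ_unique,
    Finset.prod_singleton, ite_mul, one_mul, zero_mul, Finset.sum_ite_eq', Finset.mem_univ,
    if_true, Fintype.card_unit, Nat.cast_one, one_pow, mul_one] at this
  linarith [(abs_le.1 this).2]

/-- A bad state needs noise or at least one bad neighbour. No independence is used, so the bound is
free of `l`. -/
theorem real_siteState_stepMeasure_le {b : ℕ} (hb : 3 ≤ b) (ε : I) (l : ℕ+)
    (μ : ProbabilityMeasure Config) {s : Bool} {Q : ℝ}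
    (hQ : ∀ y, (μ : Measure Config).real {ω | ω y = !s} ≤ Q) (x : Site) :
    (stepMeasure b ε l μ : Measure Config).real {ω | ω x = !s} ≤ ε + b * Q := by
  let F : (Unit → Bool) → ℝ := fun τ => if τ () = !s then 1 else 0
  have hG : ∀ τ : Unit × Fin b → Bool,
      pullback b ε F τ ≤ ε + ∑ j, if τ ((), j) = !s then (1 : ℝ) else 0 := by
    intro τ
    rw [pullback, ← (Equiv.funUnique Unit Bool).symm.sum_comp]
    rw [Fintype.sum_eq_single (!s) fun a ha => by simp [F, ha]]
    simp only [F, Equiv.funUnique_symm_apply, uniqueElim_const, Finset.univ_unique,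
      Finset.prod_singleton, if_true, one_mul]
    refine (noise_le ε _ _).trans ?_
    have hnn : ∀ j ∈ Finset.univ, 0 ≤ if τ ((), j) = !s then (1 : ℝ) else 0 :=
      fun j _ => by split_ifs <;> norm_num
    gcongr
    split_ifs with hm
    · obtain ⟨i, -, -, hi, -⟩ := exists_ne_of_majority_eq_not hb hm
      simpa [hi] using Finset.single_le_sum hnn (Finset.mem_univ i)
    · exact Finset.sum_nonneg hnn
  have hterm : ∀ c : Unit × Fin b → Site,
      ∫ ω, pullback b ε F (fun a => ω (c a)) ∂(μ : Measure Config) ≤ ε + b * Q := by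
    intro c
    have hi := integrable_marginal (μ : Measure Config) c
    have hi1 : ∀ j ∈ Finset.univ, Integrable
        (fun ω : Config => if ω (c ((), j)) = !s then (1 : ℝ) else 0) (μ : Measure Config) :=
      fun j _ => hi fun τ => if τ ((), j) = !s then (1 : ℝ) else 0
    calc _ ≤ ∫ ω, ((ε : ℝ) + ∑ j, if ω (c ((), j)) = !s then (1 : ℝ) else 0)
          ∂(μ : Measure Config) :=
          integral_mono (hi _)
            (hi fun τ => (ε : ℝ) + ∑ j, if τ ((), j) = !s then (1 : ℝ) else 0) fun ω => hG _
      _ = ε + ∑ j, (μ : Measure Config).real {ω | ω (c ((), j)) = !s} := by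
          rw [integral_add (integrable_const _) (integrable_finsetSum _ hi1),
            integral_finsetSum _ hi1]
          simp_rw [integral_siteState]
          simp
      _ ≤ ε + ∑ _j : Fin b, Q := by
          gcongr
          exact hQ _
      _ = ε + b * Q := by simp
  rw [← integral_siteState]
  have hstep := integral_stepMeasure b ε l μ (x := fun _ : Unit => x) (fun _ _ _ => rfl) F
  have hcard := card_piFinset_box l fun _ : Unit × Fin b => x
  have hN : 0 < (((l : ℕ) : ℝ) ^ 2) ^ Fintype.card (Unit × Fin b) :=
    pow_pos (pow_pos (Nat.cast_pos.2 l.pos) 2) _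
  refine hstep.trans_le ?_
  rw [div_le_iff₀ hN]
  refine (Finset.sum_le_sum fun c _ => hterm c).trans ?_
  rw [Finset.sum_const, nsmul_eq_mul, hcard, mul_comm]

theorem real_siteState_lawAt_le {b : ℕ} {p : ℝ} (hb : 3 ≤ b) (hp : 2 * (b : ℝ) ^ 2 ≤ p) {ε : I}
    (hε : 4 * (b : ℝ) ^ 2 * ε ≤ 1) (s : Bool) (n T : ℕ) {g : ℝ} (hg : 0 < g) {l : ℕ → ℕ+}
    (hl : ∀ t, ((l t : ℕ) : ℝ) ^ 2 = g * p ^ t) (x : Site) :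
    (lawAt b ε l T (allEqual s) : Measure Config).real {ω | ω x = !s} ≤
      ((b : ℝ) ^ n - 1) * ε + (b : ℝ) ^ n * (2 * ε + 2 * (b : ℝ) ^ 2 / (g * p ^ n)) := by
  have hb' : (3 : ℝ) ≤ b := by exact_mod_cast hb
  have hp0 : 0 < p := lt_of_lt_of_le (by positivity) hp
  have h0 := ε.2.1
  induction n generalizing T g l x with
  | zero =>
    have h := (productApprox_lawAt (by omega) hp ε s T hg hl).real_siteState_le x (!s)
    have h' := treeWeight_not_le hb hε s T
    simp only [pow_zero, sub_self, zero_mul, zero_add, one_mul, mul_one]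
    linarith
  | succ n ih =>
    cases T with
    | zero =>
      have hz : (lawAt b ε l 0 (allEqual s) : Measure Config).real {ω | ω x = !s} = 0 := by
        change (Measure.dirac fun _ => s : Measure Config).real {ω | ω x = !s} = 0
        rw [measureReal_def, Measure.dirac_apply' _ (measurableSet_siteState x _)]
        simp
      rw [hz]
      have h1 : (1 : ℝ) ≤ (b : ℝ) ^ (n + 1) := one_le_pow₀ (by linarith)
      have := sub_nonneg.2 h1
      positivity
    | succ T =>
      have hl' : ∀ t, ((l (t + 1) : ℕ) : ℝ) ^ 2 = g * p * p ^ t := fun t => by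
        rw [hl, pow_succ']
        ring
      rw [lawAt_succ]
      refine (real_siteState_stepMeasure_le hb ε (l 0) _
        (fun y => ih T (mul_pos hg hp0) hl' y) x).trans ?_
      rw [mul_assoc g p, ← pow_succ']
      -- The noise terms close up because `1 + b (b^n - 1) ≤ b^(n+1) - 1` for `b ≥ 2`.
      have : (ε : ℝ) * (b - 2) ≥ 0 := mul_nonneg h0 (by linarith)
      generalize 2 * (b : ℝ) ^ 2 / (g * p ^ (n + 1)) = d
      rw [pow_succ]
      linarith

theorem exists_noise_threshold {b : ℕ} (hb : 3 ≤ b) {η : ℝ} (hη : 0 < η) :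
    ∃ ε₀ : ℝ, 0 < ε₀ ∧ ∀ ε : I, (ε : ℝ) ≤ ε₀ → ∀ g p : ℝ, 1 ≤ g → 2 * (b : ℝ) ^ 2 ≤ p →
      ∀ l : ℕ → ℕ+, (∀ t, ((l t : ℕ) : ℝ) ^ 2 = g * p ^ t) → ∀ (s : Bool) (T : ℕ) (x : Site),
        (lawAt b ε l T (allEqual s) : Measure Config).real {ω | ω x = !s} ≤ η := by
  have hb' : (3 : ℝ) ≤ b := by exact_mod_cast hb
  -- This `n` makes the coincidence error `2 b² / 2^n` less than `η / 2`; the second bound on `ε`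
  -- below makes the noise part, at most `3 b^n ε`, at most `η / 2`.
  obtain ⟨n, hn⟩ := exists_pow_lt_of_lt_one (show 0 < η / (4 * (b : ℝ) ^ 2) by positivity)
    (show (1 / 2 : ℝ) < 1 by norm_num)
  rw [lt_div_iff₀ (by positivity)] at hn
  refine ⟨min (1 / (4 * (b : ℝ) ^ 2)) (η / (6 * (b : ℝ) ^ n)), by positivity, ?_⟩
  intro ε hε g p hg hp l hl s T x
  have h0 := ε.2.1
  have hp0 : 0 < p := lt_of_lt_of_le (by positivity) hp
  have hε1 := (le_div_iff₀ (by positivity)).1 (hε.trans (min_le_left _ _))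
  have hε2 := (le_div_iff₀ (by positivity)).1 (hε.trans (min_le_right _ _))
  refine (real_siteState_lawAt_le hb hp (by linarith) s n T (by linarith) hl x).trans ?_
  have hδ : (b : ℝ) ^ n * (2 * (b : ℝ) ^ 2 / (g * p ^ n)) ≤ 2 * (b : ℝ) ^ 2 * (1 / 2) ^ n := by
    calc (b : ℝ) ^ n * (2 * (b : ℝ) ^ 2 / (g * p ^ n))
        ≤ (b : ℝ) ^ n * (2 * (b : ℝ) ^ 2 / (1 * (2 * b) ^ n)) := by
          have : 2 * (b : ℝ) ≤ p := by nlinarith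
          gcongr
      _ = 2 * (b : ℝ) ^ 2 * (1 / 2) ^ n := by
          rw [mul_pow, one_div, inv_pow]
          field_simp
  nlinarith

/-! ### Non-ergodicity. -/

/-- One-site events are clopen, so their probabilities pass to the weak limit; a common limit would
give two complementary events mass at most `1/4` each. -/
theorem not_isErgodic_of_forall_real_le {b : ℕ} {ε : I} {l : ℕ → ℕ+} (x : Site)
    (h : ∀ (s : Bool) (T : ℕ),
      (lawAt b ε l T (allEqual s) : Measure Config).real {ω | ω x = !s} ≤ 1 / 4) :
    ¬ IsErgodic b ε l := by
  rintro ⟨ν, hν⟩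
  have hlim : ∀ s : Bool, (ν : Measure Config).real {ω | ω x = !s} ≤ 1 / 4 := by
    intro s
    have hclopen : IsClopen {ω : Config | ω x = !s} :=
      (isClopen_discrete {!s}).preimage (continuous_apply x)
    have ht := ProbabilityMeasure.tendsto_measure_of_isClopen_of_tendsto (hν (allEqual s)) hclopen
    exact le_of_tendsto (NNReal.tendsto_coe.2 ht)
      (Eventually.of_forall fun T => h s T)
  have hc : {ω : Config | ω x = !true}ᶜ = {ω : Config | ω x = !false} := by
    ext ω
    simp
  have hadd := probReal_add_probReal_compl (μ := (ν : Measure Config))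
    (measurableSet_siteState x (!true))
  rw [hc] at hadd
  linarith [hlim true, hlim false]

end MajorityVoter

theorem mainTheorem1 (b : ℕ) (hb : Odd b) (hb3 : 3 ≤ b) :
    ∃ g₀ p₀ : ℝ,
      (∃ ε₀ : ℝ, 0 < ε₀ ∧ ∀ ε : unitInterval, (ε : ℝ) ≤ ε₀ →
        ∀ g p : ℝ, g₀ ≤ g → p₀ ≤ p →
        ∀ l : ℕ → ℕ+, (∀ t, ((l t : ℕ) : ℝ) ^ 2 = g * p ^ t) →
          ¬ MajorityVoter.IsErgodic b ε l) ∧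
      (∀ η : ℝ, 0 < η → ∃ ε₀ : ℝ, 0 < ε₀ ∧ ∀ ε : unitInterval, (ε : ℝ) ≤ ε₀ →
        ∀ g p : ℝ, g₀ ≤ g → p₀ ≤ p →
        ∀ l : ℕ → ℕ+, (∀ t, ((l t : ℕ) : ℝ) ^ 2 = g * p ^ t) →
        ∀ T : ℕ,
          (MajorityVoter.lawAt b ε l T MajorityVoter.allPlus : MeasureTheory.Measure
            MajorityVoter.Config).real {ω | ω (0, 0) = false} ≤ η) := by
  refine ⟨1, 2 * (b : ℝ) ^ 2, ?_, fun η hη => ?_⟩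
  · obtain ⟨ε₀, h0, h⟩ := MajorityVoter.exists_noise_threshold hb3 (show (0 : ℝ) < 1 / 4 by norm_num)
    exact ⟨ε₀, h0, fun ε hε g p hg hp l hl =>
      MajorityVoter.not_isErgodic_of_forall_real_le (0, 0) fun s T => h ε hε g p hg hp l hl s T _⟩
  · obtain ⟨ε₀, h0, h⟩ := MajorityVoter.exists_noise_threshold hb3 hη
    exact ⟨ε₀, h0, fun ε hε g p hg hp l hl T => h ε hε g p hg hp l hl true T (0, 0)⟩
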